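/- Let $C$ be an algebraically closed field of characteristic zero (for instance $C=\mathbb C$) and $K=C(x,y)$, with partial derivatives $f_x,f_y$. A differential extension field of $K$ is a field extension with commuting derivations that extend $\partial/\partial x$ and $\partial/\partial y$; $df=f_x\,dx+f_y\,dy$ denotes the corresponding differential, and $f$ is constant if $df=0$. A differential extension field $L$ of $K$ is elementary if it has the same constants as $K$ and there is a tower $K=K_0\subseteq K_1\subseteq\dots\subseteq K_s=L$ such that, for each $i$, either $K_{i+1}=K_i(t)$ with $t\neq 0$ and $dt/t=dR$ for some $R\in K_i$, or $K_{i+1}=K_i(t)$ with $dt=dR/R$ for some nonzero $R\in K_i$, or $K_{i+1}$ is a finite algebraic extension of $K_i$. Let $\mathcal X=X_1\,\partial/\partial x+X_2\,\partial/\partial y$ with $X_1,X_2\in K$ be a rational vector field. A first integral of $\mathcal X$ in a differential extension field is a non-constant element $\phi$ with $X_1\phi_x+X_2\phi_y=0$; it is called elementary if it lies in an elementary extension of $K$, and rational if it lies in $K$. Say that $\mathcal X$ has a logarithmic relation over $L$ if there are $m\ge 0$, $c_1,\dots,c_m\in C$, $u_1,\dots,u_m\in L\setminus\{0\}$ and $v\in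 L$ such that the one-form $$\beta=\sum_{i=1}^m c_i\,\frac{du_i}{u_i}+dv=\beta_1\,dx+\beta_2\,dy$$ is nonzero and satisfies $X_1\beta_1+X_2\beta_2=0$. Call $\mathcal X$ exceptional if it has an elementary first integral but no logarithmic relation over $K$. For $k,h,g_1,\dots,g_m\in K$ with $k$ not a square in $K$, and $c_1,\dots,c_m\in C$, put $$H=\begin{pmatrix}-\bigl(h_y+\tfrac12 h\tfrac{k_y}{k}\bigr)\\[2pt] h_x+\tfrac12 h\tfrac{k_x}{k}\end{pmatrix}+\sum_{i=1}^m\frac{c_i}{(g_i^2-k)^2}\begin{pmatrix}-2\bigl(-g_i^2g_{i,y}+kg_{i,y}-g_ik_y\bigr)-g_i(g_i^2+k)\tfrac{k_y}{k}\\[2pt] 2\bigl(-g_i^2g_{i,x}+kg_{i,x}-g_ik_x\bigr)+g_i(g_i^2+k)\tfrac{k_x}{k}\end{pmatrix}.$$ (a) Let $\mathcal X$ be exceptional, and suppose that it has a logarithmic relation over a field extension $L$ of $K$ of degree $2$ (with the derivations extended from $K$). Then $L=K(\sqrt k)$ for some non-square $k\in K$, and for every such $k$ there are $h,g_1,\dots,g_m\in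 K$ and $c_1,\dots,c_m\in C$, linearly independent over $\mathbb Q$, such that $\mathcal X=r\,H$ for some $r\in K$. (b) Let $k,h,g_1,\dots,g_m\in K$ with $k$ not a square in $K$, and let $c_1,\dots,c_m\in C$ be arbitrary. Then $H$ is exceptional if and only if it admits no rational first integral. -/

import Mathlib

universe u

noncomputable section

namespace PlaneVF

/-- The rational function field `K = C(x, y)`; `x` is the variable `0` and `y` the variable `1`. -/
abbrev RatXY (C : Type*) [Field C] := FractionRing (MvPolynomial (Fin 2) C)

section Partial

variable (C : Type*) [Field C]

/-- The partial derivative of polynomials in the `j`-th variable, with values in `C(x, y)`. -/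
def polyPartial (j : Fin 2) : Derivation C (MvPolynomial (Fin 2) C) (RatXY C) :=
  (Algebra.linearMap (MvPolynomial (Fin 2) C) (RatXY C)).compDer (MvPolynomial.pderiv j)

/-- The partial derivative `∂ / ∂x` (for `j = 0`) or `∂ / ∂y` (for `j = 1`) on `C(x, y)`:
the unique derivation of `C(x, y)` that extends the partial derivative of polynomials (it is
obtained from `Ω[C(x,y) / C] = C(x,y) ⊗ Ω[C[x,y] / C]`). -/
def partialDeriv (j : Fin 2) : Derivation C (RatXY C) (RatXY C) :=
  have : Algebra.FormallyEtale (MvPolynomial (Fin 2) C) (RatXY C) :=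
    Algebra.FormallyEtale.of_isLocalization (nonZeroDivisors (MvPolynomial (Fin 2) C))
  ((polyPartial C j).liftKaehlerDifferential.liftBaseChange (RatXY C) ∘ₗ
    (KaehlerDifferential.tensorKaehlerEquivOfFormallyEtale C
      (MvPolynomial (Fin 2) C) (RatXY C)).symm.toLinearMap).compDer
    (KaehlerDifferential.D C (RatXY C))

/-- On polynomials, `partialDeriv` is the usual partial derivative. -/
theorem partialDeriv_algebraMap (j : Fin 2) (p : MvPolynomial (Fin 2) C) :
    partialDeriv C j (algebraMap _ (RatXY C) p) =
      algebraMap _ (RatXY C) (MvPolynomial.pderiv j p) := by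
  have : Algebra.FormallyEtale (MvPolynomial (Fin 2) C) (RatXY C) :=
    Algebra.FormallyEtale.of_isLocalization (nonZeroDivisors (MvPolynomial (Fin 2) C))
  simp [partialDeriv, polyPartial,
    KaehlerDifferential.tensorKaehlerEquivOfFormallyEtale_symm_D_algebraMap]

end Partial

section Extension

variable {C : Type*} [Field C]
variable {L : Type*} [Field L] [Algebra C L]

/-- `f` is a constant: `df = 0`. -/
def IsConstant (D : Fin 2 → Derivation C L L) (f : L) : Prop :=
  ∀ j, D j f = 0

/-- The components `β₀, β₁` of the one-form
`∑ i, c i * d(u i) / u i + dv = β₀ dx + β₁ dy` over `L`. -/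
def logForm (D : Fin 2 → Derivation C L L) {m : ℕ} (c : Fin m → C) (u : Fin m → L) (v : L) :
    Fin 2 → L :=
  fun j => ∑ i, c i • (D j (u i) / u i) + D j v

variable [Algebra (RatXY C) L]

/-- The field extension `L` of `K = C(x, y)`, with the derivations `D 0, D 1`, is a differential
extension field of `(K, ∂/∂x, ∂/∂y)`: the derivations extend the partial derivatives, and they
commute. -/
def IsDifferentialExtension (D : Fin 2 → Derivation C L L) : Prop :=
  (∀ j f, D j (algebraMap (RatXY C) L f) = algebraMap (RatXY C) L (partialDeriv C j f)) ∧
    ∀ f, D 0 (D 1 f) = D 1 (D 0 f)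

/-- The derivative `X₀ ∂f/∂x + X₁ ∂f/∂y` of `f ∈ L` along the rational vector field
`X = X₀ ∂/∂x + X₁ ∂/∂y`. -/
def lieDeriv (D : Fin 2 → Derivation C L L) (X : Fin 2 → RatXY C) (f : L) : L :=
  ∑ j, algebraMap (RatXY C) L (X j) * D j f

/-- `f ∈ L` is a first integral of `X`: it is not constant, and its derivative along `X`
vanishes. -/
def IsFirstIntegral (D : Fin 2 → Derivation C L L) (X : Fin 2 → RatXY C) (f : L) : Prop :=
  ¬ IsConstant D f ∧ lieDeriv D X f = 0

/-- There are `v ∈ L`, `u₁, …, uₘ ∈ L \ {0}` and `c₁, …, cₘ ∈ C` such that the one-form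
`β = ∑ i, c i * d(u i) / u i + dv` is not zero and annihilates `X = X₀ ∂/∂x + X₁ ∂/∂y`.
For `X = -Q ∂/∂x + P ∂/∂y` and `ω = P dx + Q dy` the latter says `β ∧ ω = 0`. -/
def HasLogRelation (D : Fin 2 → Derivation C L L) (X : Fin 2 → RatXY C) : Prop :=
  ∃ (m : ℕ) (c : Fin m → C) (u : Fin m → L) (v : L),
    (∀ i, u i ≠ 0) ∧ logForm D c u v ≠ 0 ∧
      ∑ j, algebraMap (RatXY C) L (X j) * logForm D c u v j = 0

/-- `IsElementaryTower D F`: there is a tower `K = K₀ ⊆ K₁ ⊆ … ⊆ Kₘ = F` in which every step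
adjoins an exponential, adjoins a logarithm, or is a finite algebraic extension. -/
inductive IsElementaryTower (D : Fin 2 → Derivation C L L) :
    IntermediateField (RatXY C) L → Prop
  | base : IsElementaryTower D ⊥
  | exponential (F : IntermediateField (RatXY C) L) (t R : L) (hF : IsElementaryTower D F)
      (hR : R ∈ F) (ht : t ≠ 0) (h : ∀ j, D j t / t = D j R) :
      IsElementaryTower D (F ⊔ IntermediateField.adjoin (RatXY C) {t})
  | logarithm (F : IntermediateField (RatXY C) L) (t R : L) (hF : IsElementaryTower D F)
      (hR : R ∈ F) (hR0 : R ≠ 0) (h : ∀ j, D j t = D j R / R) :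
      IsElementaryTower D (F ⊔ IntermediateField.adjoin (RatXY C) {t})
  | algebraic (F F' : IntermediateField (RatXY C) L) (hF : IsElementaryTower D F) (h : F ≤ F')
      (hfin : FiniteDimensional F (IntermediateField.extendScalars h)) :
      IsElementaryTower D F'

/-- `L`, with the derivations `D 0, D 1`, is an elementary extension of `K = C(x, y)`: it is a
differential extension field of `K` with the same constants, reached by an elementary tower. -/
def IsElementaryExtension (D : Fin 2 → Derivation C L L) : Prop :=
  IsDifferentialExtension D ∧
    (∀ f : L, IsConstant D f → ∃ a : RatXY C, algebraMap (RatXY C) L a = f) ∧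
    IsElementaryTower D (⊤ : IntermediateField (RatXY C) L)

end Extension

section VectorFields

variable {C : Type u} [Field C]

/-- `X` has an elementary first integral: some elementary extension of `C(x, y)` contains a
first integral of `X`. -/
def HasElementaryFirstIntegral (X : Fin 2 → RatXY C) : Prop :=
  ∃ (L : Type u) (_ : Field L) (_ : Algebra C L) (_ : Algebra (RatXY C) L)
    (_ : IsScalarTower C (RatXY C) L) (D : Fin 2 → Derivation C L L),
    IsElementaryExtension D ∧ ∃ f : L, IsFirstIntegral D X f

/-- `X` has a rational first integral. -/
def HasRationalFirstIntegral (X : Fin 2 → RatXY C) : Prop :=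
  ∃ f : RatXY C, IsFirstIntegral (partialDeriv C) X f

/-- `X` is exceptional: it has an elementary first integral, but there is no relation
`(∑ i, c i * d(u i) / u i + dv) ∧ ω = 0` with nonzero first factor and all `u i` and `v`
in `K = C(x, y)` itself. -/
def IsExceptional (X : Fin 2 → RatXY C) : Prop :=
  HasElementaryFirstIntegral X ∧ ¬ HasLogRelation (partialDeriv C) X

/-- `k ∈ K = C(x, y)` is not a square in `K` but has a square root in `L`. For an extension `L`
of degree two this means `L = K(√k)`. -/
def IsQuadraticGenerator (L : Type*) [Field L] [Algebra (RatXY C) L] (k : RatXY C) : Prop :=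
  ¬ IsSquare k ∧ ∃ l : L, l ^ 2 = algebraMap (RatXY C) L k

/-- The explicit vector field `H` built from `k`, `h`, constants `c i` and rational functions
`g i`; here `dx` and `dy` denote the partial derivatives with respect to `x` and `y`. -/
def quadField (k h : RatXY C) {m : ℕ} (c : Fin m → C) (g : Fin m → RatXY C) :
    Fin 2 → RatXY C :=
  let dx := partialDeriv C 0
  let dy := partialDeriv C 1
  ![-(dy h + 1 / 2 * h * (dy k / k)), dx h + 1 / 2 * h * (dx k / k)] +
    ∑ i, (c i • (1 / (g i ^ 2 - k) ^ 2)) •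
      ![-2 * (-(g i ^ 2) * dy (g i) + k * dy (g i) - g i * dy k)
          - g i * (g i ^ 2 + k) * (dy k / k),
        2 * (-(g i ^ 2) * dx (g i) + k * dx (g i) - g i * dx k)
          + g i * (g i ^ 2 + k) * (dx k / k)]

end VectorFields

end PlaneVF

end

/-! Write s = √k. Conjugation s ↦ -s splits a logarithmic form over K(s) into an invariant part,
again a logarithmic form over K up to a factor 2 (its arguments are the norms of the `u i`), and an
anti-invariant part γs with γ given by `sqrtForm`. The field H is γ rotated by a right angle
(`quadField_eq`).

For (a), X annihilates both parts of β. Without a logarithmic relation over K the invariant part is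
zero, so γ ≠ 0 and X is proportional to H: `exists_eq_smul_quadField`.

For (b), a rational first integral f gives the relation df. Conversely, if a closed form β ≠ 0 over
K annihilates H ≠ 0, then β = wγ. As wγ and sγ are both closed, d(w²/k) ∧ γ = 0, so w²/k is a
rational first integral unless it is constant; in that case k is a square because C is algebraically
closed (`not_hasLogRelation_quadField`). An elementary first integral is the primitive hs + ∑ c_i
log((g_i + s)/(g_i - s)) of γs (`hasElementaryFirstIntegral_quadField`). The delicate point is to
adjoin these logarithms without new constants (`exists_log_extension`): a logarithm is made
transcendental only when it is not already present. -/

open Polynomial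

noncomputable section

namespace PlaneVF


/-! ### Extension of derivations along formally étale algebras. -/

section Etale

variable {C A B : Type*} [CommRing C] [CommRing A] [CommRing B] [Algebra C A] [Algebra C B]
  [Algebra A B] [IsScalarTower C A B] [Algebra.FormallyEtale A B]

/-- A derivation extends along a formally étale algebra. -/
theorem exists_derivation_extension (d : Derivation C A B) :
    ∃ D : Derivation C B B, ∀ a, D (algebraMap A B a) = d a := by
  refine ⟨(d.liftKaehlerDifferential.liftBaseChange B ∘ₗ
    (KaehlerDifferential.tensorKaehlerEquivOfFormallyEtale C A B).symm.toLinearMap).compDer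
    (KaehlerDifferential.D C B), fun a => ?_⟩
  simp [KaehlerDifferential.tensorKaehlerEquivOfFormallyEtale_symm_D_algebraMap]

/-- A derivation on a formally étale algebra is determined by its restriction. -/
theorem derivation_eq_zero_of_algebraMap (D : Derivation C B B)
    (h : ∀ a, D (algebraMap A B a) = 0) (b : B) : D b = 0 := by
  have hz : D.liftKaehlerDifferential ∘ₗ
      (KaehlerDifferential.tensorKaehlerEquivOfFormallyEtale C A B).toLinearMap = 0 := by
    apply TensorProduct.AlgebraTensorModule.curry_injective
    ext a
    simp [h]
  have := LinearMap.congr_fun hz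
    ((KaehlerDifferential.tensorKaehlerEquivOfFormallyEtale C A B).symm (KaehlerDifferential.D C B b))
  simpa using this

/-- Commuting derivations extend along a formally étale algebra to commuting derivations. -/
theorem exists_commuting_extension (d : Fin 2 → Derivation C A A)
    (hd : ∀ a, d 0 (d 1 a) = d 1 (d 0 a)) :
    ∃ D : Fin 2 → Derivation C B B, (∀ j a, D j (algebraMap A B a) = algebraMap A B (d j a)) ∧
      ∀ b, D 0 (D 1 b) = D 1 (D 0 b) := by
  choose D hD using fun j : Fin 2 =>
    exists_derivation_extension (B := B) ((Algebra.linearMap A B).compDer (d j))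
  have hD' : ∀ j a, D j (algebraMap A B a) = algebraMap A B (d j a) := by
    intro j a; simp [hD]
  refine ⟨D, hD', fun b => ?_⟩
  -- The commutator is itself a derivation, so it suffices that it vanishes on `A`.
  have := derivation_eq_zero_of_algebraMap (A := A) ⁅D 0, D 1⁆ (by
    intro a; simp [Derivation.commutator_apply, hD', hd]) b
  rwa [Derivation.commutator_apply, sub_eq_zero] at this

end Etale

/-! ### Constants in fraction fields. -/

section Fractions

variable {C A K : Type*} [CommRing C] [CommRing A] [IsDomain A] [UniqueFactorizationMonoid A]
  [Field K] [Algebra C A] [Algebra C K] [Algebra A K] [IsFractionRing A K]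

/-- If a reduced fraction is killed by a derivation, the denominator divides its derivative. -/
theorem exists_reduced_fraction_dvd_derivation (f : K) : ∃ a b : A, b ≠ 0 ∧
    f = algebraMap A K a / algebraMap A K b ∧
    ∀ (d : Derivation C A A) (D : Derivation C K K),
      (∀ p, D (algebraMap A K p) = algebraMap A K (d p)) → D f = 0 →
        b * d a = a * d b ∧ b ∣ d b := by
  obtain ⟨a, b, hab, rfl⟩ := IsFractionRing.exists_reduced_fraction A f
  have hb : (b : A) ≠ 0 := nonZeroDivisors.coe_ne_zero b
  refine ⟨a, b, hb, IsFractionRing.mk'_eq_div _, fun d D hD h => ?_⟩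
  have hb' : algebraMap A K b ≠ 0 := by simp
  rw [IsFractionRing.mk'_eq_div, Derivation.leibniz_div, hD, hD, smul_eq_mul, mul_eq_zero,
    or_iff_right (by positivity), sub_eq_zero, smul_eq_mul, smul_eq_mul, ← map_mul, ← map_mul] at h
  have h' := IsFractionRing.injective A K h
  exact ⟨h', hab.symm.dvd_of_dvd_mul_left (Dvd.intro _ h')⟩

end Fractions

/-! ### Partial derivatives and constants of C(x, y). -/

section RationalFunctions

variable (C : Type*) [Field C]

theorem partialDeriv_comm (f : RatXY C) :
    partialDeriv C 0 (partialDeriv C 1 f) = partialDeriv C 1 (partialDeriv C 0 f) := by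
  have : Algebra.FormallyEtale (MvPolynomial (Fin 2) C) (RatXY C) :=
    Algebra.FormallyEtale.of_isLocalization (nonZeroDivisors (MvPolynomial (Fin 2) C))
  have hp : ∀ p : MvPolynomial (Fin 2) C, MvPolynomial.pderiv 0 (MvPolynomial.pderiv 1 p) =
      MvPolynomial.pderiv 1 (MvPolynomial.pderiv 0 p) := by
    intro p
    have : ⁅(MvPolynomial.pderiv 0 : Derivation C (MvPolynomial (Fin 2) C) _),
        (MvPolynomial.pderiv 1 : Derivation C (MvPolynomial (Fin 2) C) _)⁆ = 0 := by
      apply MvPolynomial.derivation_ext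
      intro i
      fin_cases i <;> simp [Derivation.commutator_apply, MvPolynomial.pderiv_X]
    have := DFunLike.congr_fun this p
    rwa [Derivation.commutator_apply, Derivation.zero_apply, sub_eq_zero] at this
  have := derivation_eq_zero_of_algebraMap (A := MvPolynomial (Fin 2) C)
    ⁅partialDeriv C 0, partialDeriv C 1⁆ (by
    intro a
    rw [Derivation.commutator_apply]
    simp only [partialDeriv_algebraMap, hp, sub_self]) f
  rwa [Derivation.commutator_apply, sub_eq_zero] at this

variable {C}

theorem totalDegree_pderiv_lt {j : Fin 2} {p : MvPolynomial (Fin 2) C}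
    (h : MvPolynomial.pderiv j p ≠ 0) :
    (MvPolynomial.pderiv j p).totalDegree < p.totalDegree := by
  obtain ⟨m, hm, hmd⟩ := Finset.exists_mem_eq_sup _ (MvPolynomial.support_nonempty.2 h)
    (fun s => s.sum fun _ e => e)
  have hm' := MvPolynomial.mem_support_iff.1 hm
  rw [MvPolynomial.coeff_pderiv] at hm'
  have h1 : m + Finsupp.single j 1 ∈ p.support :=
    MvPolynomial.mem_support_iff.2 (left_ne_zero_of_mul hm')
  have h2 := MvPolynomial.le_totalDegree h1
  rw [Finsupp.sum_add_index' (by simp) (by simp)] at h2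
  rw [MvPolynomial.totalDegree, hmd]
  simp only [Finsupp.sum_single_index] at h2
  omega

/-- A nonzero multiple of `p` has at least the degree of `p`, whereas differentiation lowers the
degree. -/
theorem eq_zero_of_dvd_pderiv {j : Fin 2} {p : MvPolynomial (Fin 2) C}
    (h : p ∣ MvPolynomial.pderiv j p) : MvPolynomial.pderiv j p = 0 := by
  by_contra h0
  obtain ⟨q, hq⟩ := h
  have h1 := totalDegree_pderiv_lt h0
  rw [hq] at h0 h1
  rw [MvPolynomial.totalDegree_mul_of_isDomain (left_ne_zero_of_mul h0)
    (right_ne_zero_of_mul h0)] at h1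
  omega

theorem eq_C_of_pderiv_eq_zero [CharZero C] {p : MvPolynomial (Fin 2) C}
    (h : ∀ j, MvPolynomial.pderiv j p = 0) : p = MvPolynomial.C (p.coeff 0) := by
  ext m
  rw [MvPolynomial.coeff_C]
  split_ifs with hm
  · rw [hm]
  · obtain ⟨j, hj⟩ : ∃ j, m j ≠ 0 := by
      by_contra! hc
      exact hm (Finsupp.ext fun j => (hc j).symm)
    have h1 := congrArg (MvPolynomial.coeff (m - Finsupp.single j 1)) (h j)
    have h2 : m - Finsupp.single j 1 + Finsupp.single j 1 = m :=
      tsub_add_cancel_of_le (by simpa [Nat.one_le_iff_ne_zero] using hj)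
    rw [MvPolynomial.coeff_pderiv, h2] at h1
    rw [MvPolynomial.coeff_zero, mul_eq_zero] at h1
    exact h1.resolve_right (by exact Nat.cast_add_one_ne_zero _)

/-- The constants of `C(x, y)` are the elements of `C`. -/
theorem exists_algebraMap_eq_of_isConstant [CharZero C] {f : RatXY C}
    (h : IsConstant (partialDeriv C) f) : ∃ a : C, algebraMap C (RatXY C) a = f := by
  obtain ⟨p, q, hq, hf, hpq⟩ := exists_reduced_fraction_dvd_derivation (C := C)
    (A := MvPolynomial (Fin 2) C) f
  have hj := fun j => hpq (MvPolynomial.pderiv j) (partialDeriv C j)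
    (partialDeriv_algebraMap C j) (h j)
  have hq0 : ∀ j, MvPolynomial.pderiv j q = 0 := fun j => eq_zero_of_dvd_pderiv (hj j).2
  have hp0 : ∀ j, MvPolynomial.pderiv j p = 0 := fun j => by
    have := (hj j).1
    rw [hq0, mul_zero, mul_eq_zero] at this
    exact this.resolve_left hq
  refine ⟨p.coeff 0 / q.coeff 0, ?_⟩
  rw [hf, eq_C_of_pderiv_eq_zero hp0, eq_C_of_pderiv_eq_zero hq0, map_div₀,
    IsScalarTower.algebraMap_apply C (MvPolynomial (Fin 2) C) (RatXY C),
    IsScalarTower.algebraMap_apply C (MvPolynomial (Fin 2) C) (RatXY C)]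
  simp [MvPolynomial.algebraMap_eq]

end RationalFunctions


/-! ### Adjoining primitives and logarithms without new constants. -/

section LogarithmicExtension

variable {C F : Type*} [Field C] [Field F] [Algebra C F]

/-- The derivation of `F[X]` that extends `d` and sends `X` to `e`. -/
def polyDerivation (d : Derivation C F F) (e : F) : Derivation C F[X] F[X] :=
  PolynomialModule.equivPolynomialSelf.toLinearMap.compDer d.mapCoeffs +
    Polynomial.C e • (Polynomial.derivative' (R := F)).restrictScalars C

theorem coeff_polyDerivation (d : Derivation C F F) (e : F) (p : F[X]) (n : ℕ) :
    (polyDerivation d e p).coeff n = d (p.coeff n) + e * (p.coeff (n + 1) * (n + 1)) := by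
  have : (PolynomialModule.equivPolynomial (d.mapCoeffs p)).coeff n = d (p.coeff n) := rfl
  simp [polyDerivation, this, coeff_derivative]

theorem polyDerivation_C (d : Derivation C F F) (e a : F) :
    polyDerivation d e (Polynomial.C a) = Polynomial.C (d a) := by
  ext n
  rcases n with _ | n <;> simp [coeff_polyDerivation, coeff_C]

theorem polyDerivation_X (d : Derivation C F F) (e : F) :
    polyDerivation d e X = Polynomial.C e := by
  ext n
  rcases n with _ | n <;> simp [coeff_polyDerivation, coeff_C, coeff_X, apply_ite d]

theorem polyDerivation_comm (d : Fin 2 → Derivation C F F) (e : Fin 2 → F)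
    (hd : ∀ a, d 0 (d 1 a) = d 1 (d 0 a)) (he : d 0 (e 1) = d 1 (e 0)) (p : F[X]) :
    polyDerivation (d 0) (e 0) (polyDerivation (d 1) (e 1) p) =
      polyDerivation (d 1) (e 1) (polyDerivation (d 0) (e 0) p) := by
  ext n
  simp only [coeff_polyDerivation, map_add, Derivation.leibniz, smul_eq_mul, hd, he,
    Derivation.map_natCast, Derivation.map_one_eq_zero]
  ring

theorem natDegree_polyDerivation_le (d : Derivation C F F) (e : F) (p : F[X]) :
    (polyDerivation d e p).natDegree ≤ p.natDegree := by
  rw [natDegree_le_iff_coeff_eq_zero]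
  intro n hn
  simp [coeff_polyDerivation, coeff_eq_zero_of_natDegree_lt hn,
    coeff_eq_zero_of_natDegree_lt (hn.trans (Nat.lt_succ_self n))]

/-- The leading coefficient 1 has derivative zero, so the derivative of `p` has smaller degree than
`p` and can be a multiple of it only if it is zero. -/
theorem polyDerivation_eq_zero_of_dvd {d : Derivation C F F} {e : F} {p : F[X]} (hp : p.Monic)
    (h : p ∣ polyDerivation d e p) : polyDerivation d e p = 0 := by
  by_contra h0
  obtain ⟨q, hq⟩ := h
  have hq0 : q ≠ 0 := by rintro rfl; simp [hq] at h0
  have h1 := natDegree_polyDerivation_le d e p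
  rw [hq, hp.natDegree_mul' hq0] at h1
  have h2 : (polyDerivation d e p).coeff p.natDegree = 0 := by
    rw [coeff_polyDerivation, coeff_eq_zero_of_natDegree_lt (Nat.lt_succ_self _),
      hp.coeff_natDegree]
    simp
  rw [hq, eq_C_of_natDegree_eq_zero (by omega : q.natDegree = 0), coeff_mul_C,
    hp.coeff_natDegree, one_mul] at h2
  apply hq0
  rw [eq_C_of_natDegree_eq_zero (by omega : q.natDegree = 0), h2, Polynomial.C_0]

/-- In a constant polynomial of positive degree, the two top coefficients would already yield a
primitive of `e` in `F`. -/
theorem natDegree_eq_zero_of_polyDerivation_eq_zero [CharZero F] {d : Fin 2 → Derivation C F F}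
    {e : Fin 2 → F} (he : ∀ w, ¬ ∀ j, d j w = e j) {p : F[X]}
    (h : ∀ j, polyDerivation (d j) (e j) p = 0) : p.natDegree = 0 := by
  by_contra hn
  obtain ⟨n, hn⟩ := Nat.exists_eq_succ_of_ne_zero hn
  have ha : p.coeff (n + 1) ≠ 0 := by
    rw [← Nat.succ_eq_add_one, ← hn]
    intro h0
    have : p = 0 := leadingCoeff_eq_zero.1 h0
    simp [this] at hn
  have h1 : ∀ j, d j (p.coeff (n + 1)) = 0 := fun j => by
    have := congrArg (fun q => q.coeff (n + 1)) (h j)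
    simpa [coeff_polyDerivation,
      coeff_eq_zero_of_natDegree_lt (by omega : p.natDegree < n + 1 + 1)] using this
  have hn1 : (n + 1 : F) ≠ 0 := Nat.cast_add_one_ne_zero n
  -- The top coefficient a' is constant, and the next one, a, satisfies da + (n + 1)a'e = 0; solve
  -- for e.
  refine he (-(p.coeff n / (p.coeff (n + 1) * (n + 1)))) fun j => ?_
  have h2 := congrArg (fun q => q.coeff n) (h j)
  simp only [coeff_polyDerivation, coeff_zero] at h2
  rw [map_neg, Derivation.leibniz_div_const _ _ _ (by simp [h1]), smul_eq_mul]
  field_simp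
  linear_combination -h2

/-- One can adjoin a primitive of a closed one-form without introducing new constants. -/
theorem exists_primitive_extension {C F : Type u} [Field C] [Field F] [Algebra C F] [CharZero F]
    (d : Fin 2 → Derivation C F F) (hd : ∀ a, d 0 (d 1 a) = d 1 (d 0 a))
    (e : Fin 2 → F) (he : d 0 (e 1) = d 1 (e 0)) :
    ∃ (L : Type u) (_ : Field L) (_ : Algebra C L) (_ : Algebra F L) (_ : IsScalarTower C F L)
      (D : Fin 2 → Derivation C L L) (t : L),
      (∀ j a, D j (algebraMap F L a) = algebraMap F L (d j a)) ∧
      (∀ f, D 0 (D 1 f) = D 1 (D 0 f)) ∧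
      (∀ f, IsConstant D f → ∃ a, IsConstant d a ∧ algebraMap F L a = f) ∧
      (∀ j, D j t = algebraMap F L (e j)) ∧
      ∀ S : Subfield L, (∀ a, algebraMap F L a ∈ S) → t ∈ S → S = ⊤ := by
  -- If a primitive already exists in `F`, a transcendental one would differ from it by a new
  -- constant; so `F` itself is kept.
  by_cases hw : ∃ w, ∀ j, d j w = e j
  · obtain ⟨w, hw⟩ := hw
    exact ⟨F, _, _, Algebra.id F, inferInstance, d, w, fun _ _ => rfl, hd,
      fun f hf => ⟨f, hf, rfl⟩, hw, fun S hS _ => eq_top_iff.2 fun a _ => hS a⟩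
  have hw' : ∀ w, ¬ ∀ j, d j w = e j := not_exists.1 hw
  have : Algebra.FormallyEtale F[X] (FractionRing F[X]) :=
    Algebra.FormallyEtale.of_isLocalization (nonZeroDivisors F[X])
  obtain ⟨D, hD, hDc⟩ := exists_commuting_extension (C := C) (B := FractionRing F[X])
    (fun j => polyDerivation (d j) (e j)) (polyDerivation_comm d e hd he)
  have hC : ∀ a, algebraMap F (FractionRing F[X]) a = algebraMap F[X] _ (Polynomial.C a) :=
    fun a => IsScalarTower.algebraMap_apply F F[X] _ a
  refine ⟨FractionRing F[X], inferInstance, inferInstance, inferInstance, inferInstance, D,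
    algebraMap F[X] _ X, fun j a => ?_, hDc, fun f hf => ?_, fun j => ?_, fun S hS ht => ?_⟩
  · rw [hC, hC, hD, polyDerivation_C]
  · obtain ⟨a, b, hb, hfab, hab⟩ := exists_reduced_fraction_dvd_derivation (C := C) (A := F[X]) f
    have hlc : b.leadingCoeff ≠ 0 := leadingCoeff_ne_zero.2 hb
    -- Normalising the denominator to be monic makes it a constant polynomial, hence 1; the fraction
    -- is then a polynomial, and degree zero puts it in `F`.
    set l := b.leadingCoeff⁻¹ with hl
    have hl0 : l ≠ 0 := inv_ne_zero hlc
    have hmon : (b * Polynomial.C l).Monic := monic_mul_leadingCoeff_inv hb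
    have hb0 : ∀ j, polyDerivation (d j) (e j) (b * Polynomial.C l) = 0 := fun j => by
      apply polyDerivation_eq_zero_of_dvd hmon
      have hu : IsUnit (Polynomial.C l) := isUnit_C.2 hl0.isUnit
      rw [hu.mul_right_dvd, Derivation.leibniz]
      exact dvd_add (Dvd.intro _ rfl) (((hab _ (D j) (hD j) (hf j)).2).mul_left _)
    have hb1 : b * Polynomial.C l = 1 := by
      exact hmon.natDegree_eq_zero.1 (natDegree_eq_zero_of_polyDerivation_eq_zero hw' hb0)
    have hfa : f = algebraMap F[X] _ (a * Polynomial.C l) := by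
      have hb' : algebraMap F[X] (FractionRing F[X]) b ≠ 0 := by simpa using hb
      rw [hfab, div_eq_iff hb', ← map_mul]
      congr 1
      linear_combination -a * hb1
    have ha0 : ∀ j, polyDerivation (d j) (e j) (a * Polynomial.C l) = 0 := fun j => by
      have := hf j
      rw [hfa, hD] at this
      exact (map_eq_zero_iff _ (IsFractionRing.injective F[X] _)).1 this
    have hac := eq_C_of_natDegree_eq_zero (natDegree_eq_zero_of_polyDerivation_eq_zero hw' ha0)
    refine ⟨(a * Polynomial.C l).coeff 0, fun j => ?_, by rw [hC, ← hac, hfa]⟩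
    have := ha0 j
    rw [hac, polyDerivation_C] at this
    exact Polynomial.C_eq_zero.1 this
  · rw [hC, hD, polyDerivation_X]
  · have hp : ∀ p : F[X], algebraMap F[X] (FractionRing F[X]) p ∈ S := by
      intro p
      induction p using Polynomial.induction_on' with
      | add p q hp hq => rw [map_add]; exact add_mem hp hq
      | monomial n a =>
        rw [← C_mul_X_pow_eq_monomial, map_mul, map_pow, ← hC]
        exact mul_mem (hS a) (pow_mem ht n)
    refine eq_top_iff.2 fun f _ => ?_
    obtain ⟨p, q, -, rfl⟩ := IsFractionRing.div_surjective (A := F[X]) f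
    exact div_mem (hp p) (hp q)

/-- One can adjoin finitely many logarithms without introducing new constants. -/
theorem exists_log_extension {C F : Type u} [Field C] [Field F] [Algebra C F] [CharZero F]
    (d : Fin 2 → Derivation C F F) (hd : ∀ a, d 0 (d 1 a) = d 1 (d 0 a))
    {n : ℕ} (u : Fin n → F) (hu : ∀ i, u i ≠ 0) :
    ∃ (L : Type u) (_ : Field L) (_ : Algebra C L) (_ : Algebra F L) (_ : IsScalarTower C F L)
      (D : Fin 2 → Derivation C L L) (t : Fin n → L),
      (∀ j a, D j (algebraMap F L a) = algebraMap F L (d j a)) ∧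
      (∀ f, D 0 (D 1 f) = D 1 (D 0 f)) ∧
      (∀ f, IsConstant D f → ∃ a, IsConstant d a ∧ algebraMap F L a = f) ∧
      (∀ i j, D j (t i) = algebraMap F L (d j (u i) / u i)) ∧
      ∀ S : Subfield L, (∀ a, algebraMap F L a ∈ S) → (∀ i, t i ∈ S) → S = ⊤ := by
  induction n with
  | zero =>
    exact ⟨F, _, _, Algebra.id F, inferInstance, d, Fin.elim0, fun _ _ => rfl, hd,
      fun f hf => ⟨f, hf, rfl⟩, fun i => i.elim0, fun S hS _ => eq_top_iff.2 fun a _ => hS a⟩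
  | succ n ih =>
    obtain ⟨L, _, _, _, _, D, t, hD, hDc, hDk, ht, htS⟩ := ih (fun i => u i.castSucc)
      fun i => hu _
    have : CharZero L := charZero_of_injective_algebraMap (algebraMap F L).injective
    have h0 := hu (Fin.last n)
    obtain ⟨M, _, _, _, _, E, s, hE, hEc, hEk, hs, hsS⟩ := exists_primitive_extension D hDc
      (fun j => algebraMap F L (d j (u (Fin.last n)) / u (Fin.last n))) (by
        rw [hD, hD, Derivation.leibniz_div, Derivation.leibniz_div, hd]
        simp only [smul_eq_mul]
        congr 1
        ring)
    let _ : Algebra F M := Algebra.compHom M (algebraMap F L)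
    have : IsScalarTower F L M := IsScalarTower.of_algebraMap_eq fun _ => rfl
    have hFM : ∀ a, algebraMap F M a = algebraMap L M (algebraMap F L a) := fun _ => rfl
    refine ⟨M, inferInstance, inferInstance, inferInstance, ?_, E,
      Fin.snoc (fun i => algebraMap L M (t i)) s, fun j a => ?_, hEc, fun f hf => ?_,
      fun i j => ?_, fun S hS hS' => ?_⟩
    · refine IsScalarTower.of_algebraMap_eq fun c => ?_
      rw [hFM, ← IsScalarTower.algebraMap_apply C F L, ← IsScalarTower.algebraMap_apply C L M]
    · rw [hFM, hFM, hE, hD]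
    · obtain ⟨a, ha, rfl⟩ := hEk f hf
      obtain ⟨b, hb, rfl⟩ := hDk a ha
      exact ⟨b, hb, rfl⟩
    · induction i using Fin.lastCases with
      | last => rw [Fin.snoc_last, hFM]; exact hs j
      | cast i => simp only [Fin.snoc_castSucc]; rw [hE, ht, hFM]
    · refine hsS S (fun a => ?_) (by simpa using hS' (Fin.last n))
      have : S.comap (algebraMap L M) = ⊤ :=
        htS _ (fun a => hS a) fun i => by simpa using hS' i.castSucc
      exact (this ▸ Subfield.mem_top a : a ∈ S.comap (algebraMap L M))

end LogarithmicExtension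


/-! ### Closedness of logarithmic forms and independence of their coefficients. -/

section LogForms

variable {C F : Type*} [Field C] [Field F] [Algebra C F]

/-- The logarithmic derivative as a homomorphism from the multiplicative to the additive group. -/
def logDerivHom (d : Derivation C F F) : Additive Fˣ →+ F where
  toFun u := d (u.toMul : F) / (u.toMul : F)
  map_zero' := by simp
  map_add' u v := by
    simp only [toMul_add, Units.val_mul, Derivation.leibniz, smul_eq_mul]
    field_simp
    ring

theorem logForm_closed (D : Fin 2 → Derivation C F F) (hD : ∀ f, D 0 (D 1 f) = D 1 (D 0 f))
    {m : ℕ} (c : Fin m → C) (u : Fin m → F) (v : F) :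
    D 0 (logForm D c u v 1) = D 1 (logForm D c u v 0) := by
  simp only [logForm, map_add, map_sum, Derivation.map_smul, hD]
  congr 1
  refine Finset.sum_congr rfl fun i _ => ?_
  rw [Derivation.leibniz_div, Derivation.leibniz_div, hD]
  simp only [smul_eq_mul]
  congr 2
  ring

/-- The coefficients of a logarithmic form may be chosen linearly independent over `ℚ`. -/
theorem exists_logForm_eq_linearIndependent [CharZero C] (D : Fin 2 → Derivation C F F) {m : ℕ}
    (c : Fin m → C) (u : Fin m → F) (hu : ∀ i, u i ≠ 0) (v : F) :
    ∃ (n : ℕ) (c' : Fin n → C) (u' : Fin n → F), LinearIndependent ℚ c' ∧ (∀ i, u' i ≠ 0) ∧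
      logForm D c u v = logForm D c' u' v := by
  -- The span is taken over ℤ rather than ℚ: it is free of finite rank, and coordinates in a basis
  -- are integers, so they serve as exponents of the `u i` without extracting roots.
  let S := Submodule.span ℤ (Set.range c)
  have hS : Module.Finite ℤ S := Module.Finite.span_of_finite ℤ (Set.finite_range c)
  let e := Module.finBasis ℤ S
  let U : Fin m → Additive Fˣ := fun i => Additive.ofMul (Units.mk0 (u i) (hu i))
  let N : Fin m → Fin (Module.finrank ℤ S) → ℤ :=
    fun i => e.repr ⟨c i, Submodule.subset_span ⟨i, rfl⟩⟩
  have hN : ∀ i, c i = ∑ l, N i l • (e l : C) := fun i => by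
    have := congrArg Subtype.val (e.sum_repr ⟨c i, Submodule.subset_span ⟨i, rfl⟩⟩)
    exact this.symm.trans (by simp [N, -Module.Basis.sum_repr])
  let W : Fin (Module.finrank ℤ S) → Additive Fˣ := fun l => ∑ i, N i l • U i
  refine ⟨_, fun l => (e l : C), fun l => (W l).toMul, ?_, fun l => Units.ne_zero _, ?_⟩
  · rw [← LinearIndependent.iff_fractionRing ℤ ℚ]
    exact e.linearIndependent.map' S.subtype S.ker_subtype
  · funext j
    simp only [logForm]
    congr 1
    change ∑ i, c i • logDerivHom (D j) (U i) = ∑ l, (e l : C) • logDerivHom (D j) (W l)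
    simp only [W, map_sum, map_zsmul, Finset.smul_sum]
    rw [Finset.sum_comm]
    refine Finset.sum_congr rfl fun i _ => ?_
    rw [hN i, Finset.sum_smul]
    refine Finset.sum_congr rfl fun l _ => ?_
    rw [smul_assoc, smul_comm]

end LogForms

/-! ### Quadratic extensions K(√k). -/

section QuadraticExtension

variable {K F : Type*} [Field K] [Field F] [Algebra K F]

theorem exists_add_mul_eq (h2 : Module.finrank K F = 2) {s : F}
    (hs : ∀ a, algebraMap K F a ≠ s) (x : F) :
    ∃ a b, x = algebraMap K F a + algebraMap K F b * s := by
  have hli : LinearIndependent K ![(1 : F), s] := by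
    rw [LinearIndependent.pair_iff' one_ne_zero]
    simpa [Algebra.smul_def] using hs
  have := hli.span_eq_top_of_card_eq_finrank (by simp [h2])
  have hx : x ∈ Submodule.span K (Set.range ![(1 : F), s]) := this ▸ Submodule.mem_top
  rw [Matrix.range_cons, Matrix.range_cons, Matrix.range_empty, Set.union_empty,
    Set.singleton_union, Submodule.mem_span_pair] at hx
  obtain ⟨a, b, rfl⟩ := hx
  exact ⟨a, b, by simp [Algebra.smul_def]⟩

theorem algebraMap_ne_of_not_isSquare {k : K} (hk : ¬ IsSquare k) {s : F}
    (hs : s ^ 2 = algebraMap K F k) (a : K) : algebraMap K F a ≠ s := by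
  rintro rfl
  rw [← map_pow] at hs
  exact hk ⟨a, by rw [← pow_two]; exact ((algebraMap K F).injective hs).symm⟩

theorem add_mul_eq_zero_iff {s : F} (hs : ∀ a, algebraMap K F a ≠ s) {a b : K} :
    algebraMap K F a + algebraMap K F b * s = 0 ↔ a = 0 ∧ b = 0 := by
  refine ⟨fun h => ?_, by rintro ⟨rfl, rfl⟩; simp⟩
  have hb : b = 0 := by
    by_contra hb
    have hb' : algebraMap K F b ≠ 0 := by simpa using hb
    refine hs (-a / b) ?_
    rw [map_div₀, map_neg, div_eq_iff hb']
    linear_combination -h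
  subst hb
  simpa using h

/-- A quadratic extension in characteristic different from two is generated by a square root. -/
theorem exists_sqrt_generator [CharZero K] (h2 : Module.finrank K F = 2) :
    ∃ k : K, ¬ IsSquare k ∧ ∃ s : F, s ^ 2 = algebraMap K F k := by
  obtain ⟨x, hx⟩ : ∃ x : F, ∀ a, algebraMap K F a ≠ x := by
    by_contra! hc
    have := Subalgebra.bot_eq_top_iff_finrank_eq_one (F := K) (E := F)
    rw [h2] at this
    have hbt : (⊥ : Subalgebra K F) = ⊤ := eq_top_iff.2 fun x _ => Algebra.mem_bot.2 (hc x)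
    simpa using this.1 hbt
  obtain ⟨p, q, hpq⟩ := exists_add_mul_eq h2 hx (x ^ 2)
  have : CharZero F := charZero_of_injective_algebraMap (algebraMap K F).injective
  have hs : (x - algebraMap K F (q / 2)) ^ 2 = algebraMap K F (p + q ^ 2 / 4) := by
    simp only [map_add, map_div₀, map_pow, map_ofNat]
    linear_combination hpq
  refine ⟨p + q ^ 2 / 4, ?_, _, hs⟩
  rintro ⟨l, hl⟩
  rw [hl, map_mul, ← sub_eq_zero, pow_two, mul_self_sub_mul_self, mul_eq_zero] at hs
  rcases hs with hs | hs
  · exact hx (q / 2 - l) (by rw [map_sub]; linear_combination -hs)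
  · exact hx (q / 2 + l) (by rw [map_add]; linear_combination -hs)

end QuadraticExtension

/-! ### Invariant and anti-invariant parts of logarithmic forms over K(√k). -/

section AntiInvariant

variable {C K : Type*} [Field C] [Field K] [Algebra C K]

/-- The logarithmic derivative of `(g + √k) / (g - √k)`, divided by `√k`. -/
def sqrtLogDeriv (d : Derivation C K K) (k g : K) : K :=
  (g * (d k / k) - 2 * d g) / (g ^ 2 - k)

/-- The derivative of `h√k + ∑ i, c i * log ((g i + √k) / (g i - √k))`, divided by `√k`. -/
def sqrtForm (d : Derivation C K K) (k h : K) {m : ℕ} (c : Fin m → C) (g : Fin m → K) : K :=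
  d h + 1 / 2 * h * (d k / k) + ∑ i, c i • sqrtLogDeriv d k (g i)

variable {F : Type*} [Field F] [Algebra C F] [Algebra K F]

theorem sq_sub_ne_zero {k : K} (hk : ¬ IsSquare k) (g : K) : g ^ 2 - k ≠ 0 := fun h =>
  hk ⟨g, by linear_combination -h⟩

theorem derivation_sqrt [CharZero K] {d : Derivation C K K} {D : Derivation C F F}
    (hD : ∀ a, D (algebraMap K F a) = algebraMap K F (d a)) {k : K} (hk : k ≠ 0) {s : F}
    (hs : s ^ 2 = algebraMap K F k) : D s = s * algebraMap K F (1 / 2 * (d k / k)) := by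
  have : CharZero F := charZero_of_injective_algebraMap (algebraMap K F).injective
  have hk' : algebraMap K F k ≠ 0 := by simpa using hk
  have hs0 : s ≠ 0 := by rintro rfl; apply hk'; rw [← hs]; simp
  have h := congrArg D hs
  rw [hD, Derivation.leibniz_pow] at h
  simp only [smul_eq_mul, nsmul_eq_mul, Nat.cast_ofNat, Nat.add_one_sub_one, pow_one] at h
  have h' : s * (2 * D s - 2 * (s * algebraMap K F (1 / 2 * (d k / k)))) = 0 := by
    simp only [map_mul, map_div₀, map_one, map_ofNat]
    rw [← h, ← hs]
    field_simp
    ring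
  have h2 := (mul_eq_zero.1 h').resolve_left hs0
  have : (2 : F) * (D s - s * algebraMap K F (1 / 2 * (d k / k))) = 0 := by
    linear_combination h2
  exact sub_eq_zero.1 ((mul_eq_zero.1 this).resolve_left two_ne_zero)

theorem derivation_add_mul_sqrt [CharZero K] {d : Derivation C K K} {D : Derivation C F F}
    (hD : ∀ a, D (algebraMap K F a) = algebraMap K F (d a)) {k : K} (hk : k ≠ 0) {s : F}
    (hs : s ^ 2 = algebraMap K F k) (a b : K) :
    D (algebraMap K F a + algebraMap K F b * s) =
      algebraMap K F (d a) + algebraMap K F (d b + 1 / 2 * b * (d k / k)) * s := by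
  rw [map_add, Derivation.leibniz, hD, hD, derivation_sqrt hD hk hs]
  simp only [smul_eq_mul, map_add, map_mul]
  ring

/-- The logarithmic derivative of `a + b√k`, split into its invariant and anti-invariant parts. -/
theorem logDeriv_add_mul_sqrt [CharZero K] {d : Derivation C K K} {D : Derivation C F F}
    (hD : ∀ a, D (algebraMap K F a) = algebraMap K F (d a)) {k : K} (hk : ¬ IsSquare k) {s : F}
    (hs : s ^ 2 = algebraMap K F k) {a b : K}
    (hab : algebraMap K F a + algebraMap K F b * s ≠ 0) :
    a ^ 2 - k * b ^ 2 ≠ 0 ∧ D (algebraMap K F a + algebraMap K F b * s) /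
        (algebraMap K F a + algebraMap K F b * s) =
      algebraMap K F (1 / 2 * (d (a ^ 2 - k * b ^ 2) / (a ^ 2 - k * b ^ 2))) +
        algebraMap K F (1 / 2 * sqrtLogDeriv d k (a / b)) * s := by
  have hk0 : k ≠ 0 := by rintro rfl; exact hk (IsSquare.zero)
  have hN : a ^ 2 - k * b ^ 2 ≠ 0 := by
    intro h
    by_cases hb : b = 0
    · subst hb
      have ha : a = 0 := by simpa using h
      simp [ha] at hab
    · exact sq_sub_ne_zero hk (a / b) (by field_simp; linear_combination h)
  refine ⟨hN, ?_⟩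
  rw [div_eq_iff hab, derivation_add_mul_sqrt hD hk0 hs]
  have e1 : d a = 1 / 2 * (d (a ^ 2 - k * b ^ 2) / (a ^ 2 - k * b ^ 2)) * a +
      1 / 2 * sqrtLogDeriv d k (a / b) * b * k := by
    by_cases hb : b = 0
    · subst hb
      have ha : a ≠ 0 := by rintro rfl; simp at hN
      simp [sqrtLogDeriv, Derivation.leibniz_pow]
      field_simp
    · have := sq_sub_ne_zero hk (a / b)
      simp only [sqrtLogDeriv, map_sub, Derivation.leibniz, Derivation.leibniz_pow,
        Derivation.leibniz_div, smul_eq_mul, nsmul_eq_mul]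
      have h3 : (a / b) ^ 2 - k = (a ^ 2 - k * b ^ 2) / b ^ 2 := by field_simp
      rw [h3]
      field_simp
      ring
  have e2 : d b + 1 / 2 * b * (d k / k) =
      1 / 2 * (d (a ^ 2 - k * b ^ 2) / (a ^ 2 - k * b ^ 2)) * b +
      1 / 2 * sqrtLogDeriv d k (a / b) * a := by
    by_cases hb : b = 0
    · subst hb
      simp [sqrtLogDeriv]
    · have := sq_sub_ne_zero hk (a / b)
      simp only [sqrtLogDeriv, map_sub, Derivation.leibniz, Derivation.leibniz_pow,
        Derivation.leibniz_div, smul_eq_mul, nsmul_eq_mul]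
      have h3 : (a / b) ^ 2 - k = (a ^ 2 - k * b ^ 2) / b ^ 2 := by field_simp
      rw [h3]
      generalize hNe : a ^ 2 - k * b ^ 2 = N at hN
      field_simp
      rw [← hNe]
      ring
  rw [e1, e2]
  simp only [map_add, map_mul, ← hs]
  ring

theorem add_sqrt_ne_zero {k : K} (hk : ¬ IsSquare k) {s : F}
    (hs : s ^ 2 = algebraMap K F k) (g : K) : algebraMap K F g + s ≠ 0 := by
  intro h
  refine algebraMap_ne_of_not_isSquare hk hs (-g) ?_
  rw [map_neg]
  linear_combination -h

theorem sub_sqrt_ne_zero {k : K} (hk : ¬ IsSquare k) {s : F}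
    (hs : s ^ 2 = algebraMap K F k) (g : K) : algebraMap K F g - s ≠ 0 := fun h =>
  algebraMap_ne_of_not_isSquare hk hs g (sub_eq_zero.1 h)

theorem logForm_sqrt [CharZero K] [IsScalarTower C K F] {d : Fin 2 → Derivation C K K}
    {D : Fin 2 → Derivation C F F}
    (hD : ∀ j a, D j (algebraMap K F a) = algebraMap K F (d j a)) {k : K} (hk : ¬ IsSquare k)
    {s : F} (hs : s ^ 2 = algebraMap K F k) (h : K) {m : ℕ} (c : Fin m → C) (g : Fin m → K)
    (j : Fin 2) :
    logForm D c (fun i => (algebraMap K F (g i) + s) / (algebraMap K F (g i) - s))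
      (algebraMap K F h * s) j = algebraMap K F (sqrtForm (d j) k h c g) * s := by
  have hk0 : k ≠ 0 := by rintro rfl; exact hk (IsSquare.zero)
  have hg : ∀ g : K, D j ((algebraMap K F g + s) / (algebraMap K F g - s)) /
      ((algebraMap K F g + s) / (algebraMap K F g - s)) =
      algebraMap K F (sqrtLogDeriv (d j) k g) * s := by
    intro g
    have h1 := add_sqrt_ne_zero hk hs g
    have h2 := sub_sqrt_ne_zero hk hs g
    have h3 : algebraMap K F k ≠ 0 := by simpa using hk0
    have h4 : algebraMap K F g ^ 2 - algebraMap K F k =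
        (algebraMap K F g + s) * (algebraMap K F g - s) := by rw [← hs]; ring
    rw [Derivation.leibniz_div, map_add, map_sub, hD, derivation_sqrt (hD j) hk0 hs]
    have : CharZero F := charZero_of_injective_algebraMap (algebraMap K F).injective
    simp only [sqrtLogDeriv, map_div₀, map_sub, map_mul, map_pow, map_ofNat, map_one,
      smul_eq_mul, h4]
    field_simp
    ring
  have hh : D j (algebraMap K F h * s) =
      algebraMap K F (d j h + 1 / 2 * h * (d j k / k)) * s := by
    simpa using derivation_add_mul_sqrt (hD j) hk0 hs 0 h
  simp only [logForm, sqrtForm, hg, hh, map_add, map_sum, add_mul, Finset.sum_mul]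
  rw [add_comm]
  congr 1
  refine Finset.sum_congr rfl fun i _ => ?_
  simp only [Algebra.smul_def, map_mul, ← IsScalarTower.algebraMap_apply]
  ring

end AntiInvariant

/-- The numerator of each summand of H is divisible by `g i ^ 2 - k`; cancelling it leaves
`sqrtLogDeriv`. -/
theorem quadField_eq {C : Type u} [Field C] {k : RatXY C} (hk : ¬ IsSquare k) (h : RatXY C)
    {m : ℕ} (c : Fin m → C) (g : Fin m → RatXY C) :
    quadField k h c g = ![-sqrtForm (partialDeriv C 1) k h c g,
      sqrtForm (partialDeriv C 0) k h c g] := by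
  have hk0 : k ≠ 0 := by rintro rfl; exact hk (IsSquare.zero)
  have key : ∀ (j : Fin 2) (g : RatXY C), 1 / (g ^ 2 - k) ^ 2 *
      (2 * (-(g ^ 2) * partialDeriv C j g + k * partialDeriv C j g - g * partialDeriv C j k)
        + g * (g ^ 2 + k) * (partialDeriv C j k / k)) = sqrtLogDeriv (partialDeriv C j) k g := by
    intro j g
    have := sq_sub_ne_zero hk g
    rw [sqrtLogDeriv]
    field_simp
    ring
  funext j
  fin_cases j
  · simp only [quadField, sqrtForm, ← key]
    simp only [Pi.add_apply, Finset.sum_apply, Pi.smul_apply, Fin.zero_eta, Matrix.cons_val_zero,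
      smul_eq_mul, neg_add, ← Finset.sum_neg_distrib]
    congr 1
    refine Finset.sum_congr rfl fun i _ => ?_
    rw [smul_mul_assoc, ← smul_neg]
    congr 1
    ring
  · simp only [quadField, sqrtForm, ← key]
    simp [Finset.sum_apply]


/-- The orthogonal of a nonzero vector of the plane is a line. This yields both X = rH and β = wγ.
-/
theorem exists_eq_mul_of_mul_add_mul_eq_zero {K : Type*} [Field K] {x y p q : K}
    (h : x * p + y * q = 0) (hpq : ¬ (p = 0 ∧ q = 0)) : ∃ r, x = r * -q ∧ y = r * p := by
  by_cases hp : p = 0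
  · have hq : q ≠ 0 := fun hq => hpq ⟨hp, hq⟩
    refine ⟨-x / q, by field_simp, ?_⟩
    field_simp
    linear_combination h
  · refine ⟨y / p, ?_, by field_simp⟩
    field_simp
    linear_combination h

/-! ### Logarithmic relations over K(√k) and the form of X. -/

section

variable {C : Type u} [Field C]

theorem HasRationalFirstIntegral.hasLogRelation {X : Fin 2 → RatXY C}
    (h : HasRationalFirstIntegral X) : HasLogRelation (partialDeriv C) X := by
  obtain ⟨f, hf, hX⟩ := h
  have hl : logForm (partialDeriv C) ![] ![] f = fun j => partialDeriv C j f := by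
    funext j; simp [logForm]
  refine ⟨0, ![], ![], f, fun i => i.elim0, fun h0 => hf fun j => ?_, ?_⟩
  · rw [hl] at h0
    exact congrFun h0 j
  · rw [hl]
    exact hX

theorem hasRationalFirstIntegral_zero :
    HasRationalFirstIntegral (0 : Fin 2 → RatXY C) := by
  refine ⟨algebraMap (MvPolynomial (Fin 2) C) _ (MvPolynomial.X 0), fun h => ?_, by simp [lieDeriv]⟩
  have := h 0
  rw [partialDeriv_algebraMap, MvPolynomial.pderiv_X_self, map_one] at this
  exact one_ne_zero this

variable [CharZero C]

/-- Every non-square of `C(x, y)` has a square root in a quadratic differential extension. -/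
theorem exists_quadratic_extension {k : RatXY C} (hk : ¬ IsSquare k) :
    ∃ (F : Type u) (_ : Field F) (_ : Algebra C F) (_ : Algebra (RatXY C) F)
      (_ : IsScalarTower C (RatXY C) F) (D : Fin 2 → Derivation C F F) (s : F),
      (∀ j a, D j (algebraMap (RatXY C) F a) = algebraMap (RatXY C) F (partialDeriv C j a)) ∧
      (∀ f, D 0 (D 1 f) = D 1 (D 0 f)) ∧ s ^ 2 = algebraMap (RatXY C) F k ∧
      Module.finrank (RatXY C) F = 2 := by
  have hirr : Irreducible (X ^ 2 - Polynomial.C k : (RatXY C)[X]) := by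
    refine (X_pow_sub_C_irreducible_iff_of_prime Nat.prime_two).2 fun b hb => hk ⟨b, ?_⟩
    rw [← hb, pow_two]
  have := Fact.mk hirr
  have hne : (X ^ 2 - Polynomial.C k : (RatXY C)[X]) ≠ 0 := hirr.ne_zero
  have hfin : Module.Finite (RatXY C) (AdjoinRoot (X ^ 2 - Polynomial.C k)) :=
    (AdjoinRoot.powerBasis hne).finite
  have : Algebra.FormallyEtale (RatXY C) (AdjoinRoot (X ^ 2 - Polynomial.C k)) :=
    Algebra.FormallyEtale.of_isSeparable _ _
  obtain ⟨D, hD, hDc⟩ := exists_commuting_extension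
    (B := AdjoinRoot (X ^ 2 - Polynomial.C k)) (partialDeriv C) (partialDeriv_comm C)
  refine ⟨AdjoinRoot (X ^ 2 - Polynomial.C k), inferInstance, inferInstance, inferInstance,
    inferInstance, D, AdjoinRoot.root _, hD, hDc, ?_, ?_⟩
  · have := AdjoinRoot.eval₂_root (X ^ 2 - Polynomial.C k)
    simpa [sub_eq_zero] using this
  · rw [(AdjoinRoot.powerBasis hne).finrank, AdjoinRoot.powerBasis_dim,
      natDegree_X_pow_sub_C]

/-- The form γs is logarithmic over K(√k), hence closed; dividing dx(γ₁s) = dy(γ₀s) by s gives the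
identity. -/
theorem sqrtForm_closed {k : RatXY C} (hk : ¬ IsSquare k) (h : RatXY C) {m : ℕ} (c : Fin m → C)
    (g : Fin m → RatXY C) :
    partialDeriv C 0 (sqrtForm (partialDeriv C 1) k h c g) +
        1 / 2 * sqrtForm (partialDeriv C 1) k h c g * (partialDeriv C 0 k / k) =
      partialDeriv C 1 (sqrtForm (partialDeriv C 0) k h c g) +
        1 / 2 * sqrtForm (partialDeriv C 0) k h c g * (partialDeriv C 1 k / k) := by
  have hk0 : k ≠ 0 := by rintro rfl; exact hk (IsSquare.zero)
  obtain ⟨F, _, _, _, _, D, s, hD, hDc, hs, -⟩ := exists_quadratic_extension hk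
  have hcl := logForm_closed D hDc c
    (fun i => (algebraMap _ F (g i) + s) / (algebraMap _ F (g i) - s)) (algebraMap _ F h * s)
  rw [logForm_sqrt hD hk hs, logForm_sqrt hD hk hs] at hcl
  have hd : ∀ j (b : RatXY C), D j (algebraMap _ F b * s) =
      algebraMap _ F (partialDeriv C j b + 1 / 2 * b * (partialDeriv C j k / k)) * s := by
    intro j b
    simpa using derivation_add_mul_sqrt (hD j) hk0 hs 0 b
  rw [hd, hd] at hcl
  have hs0 : s ≠ 0 := by
    rintro rfl
    exact algebraMap_ne_of_not_isSquare hk hs 0 (map_zero _)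
  exact (algebraMap (RatXY C) F).injective (mul_right_cancel₀ hs0 hcl)

/-- A vector field with a logarithmic relation over `K(√k)`, but none over `K`, is a multiple
of some `H`. -/
theorem exists_eq_smul_quadField {L : Type*} [Field L] [Algebra C L] [Algebra (RatXY C) L]
    [IsScalarTower C (RatXY C) L] {D : Fin 2 → Derivation C L L}
    (hD : ∀ j a, D j (algebraMap (RatXY C) L a) = algebraMap (RatXY C) L (partialDeriv C j a))
    (h2 : Module.finrank (RatXY C) L = 2) {X : Fin 2 → RatXY C}
    (hX : ¬ HasLogRelation (partialDeriv C) X) (hL : HasLogRelation D X) {k : RatXY C}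
    (hk : ¬ IsSquare k) {s : L} (hs : s ^ 2 = algebraMap (RatXY C) L k) :
    ∃ (r h : RatXY C) (m : ℕ) (c : Fin m → C) (g : Fin m → RatXY C),
      LinearIndependent ℚ c ∧ X = r • quadField k h c g := by
  have hk0 : k ≠ 0 := by rintro rfl; exact hk (IsSquare.zero)
  have hsK := algebraMap_ne_of_not_isSquare hk hs
  have : CharZero L := charZero_of_injective_algebraMap (algebraMap (RatXY C) L).injective
  obtain ⟨m₀, c₀, u₀, v, hu₀, hne, hrel⟩ := hL
  obtain ⟨m, c, u, hc, hu, huu⟩ := exists_logForm_eq_linearIndependent D c₀ u₀ hu₀ v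
  rw [huu] at hne hrel
  choose a b hab using fun i => exists_add_mul_eq h2 hsK (u i)
  obtain ⟨p, q, hpq⟩ := exists_add_mul_eq h2 hsK v
  have hsplit := fun i j => logDeriv_add_mul_sqrt (hD j) hk hs (hab i ▸ hu i)
  -- 2β = P + Qs. Doubling β removes the halves: the invariant part has the norms of the `u i` as
  -- arguments and the trace `2 * p` of `v` as exact part.
  let P := logForm (partialDeriv C) c (fun i => (a i ^ 2 - k * b i ^ 2)) (2 * p)
  let Q : Fin 2 → RatXY C := fun j => sqrtForm (partialDeriv C j) k (2 * q) c fun i => a i / b i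
  have hβ : ∀ j, 2 * logForm D c u v j =
      algebraMap (RatXY C) L (P j) + algebraMap (RatXY C) L (Q j) * s := by
    intro j
    have hu' : ∀ i, D j (u i) / u i = algebraMap (RatXY C) L (1 / 2 *
        (partialDeriv C j (a i ^ 2 - k * b i ^ 2) / (a i ^ 2 - k * b i ^ 2))) +
        algebraMap (RatXY C) L (1 / 2 * sqrtLogDeriv (partialDeriv C j) k (a i / b i)) * s :=
      fun i => by rw [hab i]; exact (hsplit i j).2
    have hsum : 2 * ∑ i, c i • (D j (u i) / u i) = algebraMap (RatXY C) L
          (∑ i, c i • (partialDeriv C j (a i ^ 2 - k * b i ^ 2) / (a i ^ 2 - k * b i ^ 2))) +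
        algebraMap (RatXY C) L
          (∑ i, c i • sqrtLogDeriv (partialDeriv C j) k (a i / b i)) * s := by
      rw [map_sum, map_sum, Finset.mul_sum, Finset.sum_mul, ← Finset.sum_add_distrib]
      refine Finset.sum_congr rfl fun i _ => ?_
      rw [hu' i]
      simp only [Algebra.smul_def, map_mul, ← IsScalarTower.algebraMap_apply, map_one, map_ofNat,
        map_div₀ _ (1 : RatXY C) 2]
      ring
    have hv : 2 * D j v = algebraMap (RatXY C) L (partialDeriv C j (2 * p)) +
        algebraMap (RatXY C) L
          (partialDeriv C j (2 * q) + 1 / 2 * (2 * q) * (partialDeriv C j k / k)) * s := by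
      rw [hpq, derivation_add_mul_sqrt (hD j) hk0 hs, two_mul p, two_mul q]
      simp only [map_add, map_mul, map_one, map_ofNat, map_div₀ _ (1 : RatXY C) 2]
      ring
    simp only [logForm, P, Q, sqrtForm]
    rw [map_add _ (Finset.sum _ _), map_add _ _ (Finset.sum _ _)]
    linear_combination hsum + hv
  have hrel' : algebraMap (RatXY C) L (∑ j, X j * P j) +
      algebraMap (RatXY C) L (∑ j, X j * Q j) * s = 0 := by
    rw [Fin.sum_univ_two] at hrel
    rw [Fin.sum_univ_two, Fin.sum_univ_two]
    simp only [map_add, map_mul]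
    linear_combination 2 * hrel - algebraMap _ L (X 0) * hβ 0 - algebraMap _ L (X 1) * hβ 1
  obtain ⟨hXP, hXQ⟩ := (add_mul_eq_zero_iff hsK).1 hrel'
  -- Otherwise P would itself be a logarithmic relation over K.
  have hP : P = 0 := by
    by_contra hP
    exact hX ⟨m, c, _, _, fun i => (hsplit i 0).1, hP, hXP⟩
  have hQ : ¬ (Q 0 = 0 ∧ Q 1 = 0) := by
    rintro ⟨h0, h1⟩
    refine hne ?_
    funext j
    have := hβ j
    have hQj : Q j = 0 := (Fin.forall_fin_two (p := fun j => Q j = 0)).2 ⟨h0, h1⟩ j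
    simpa [hP, hQj] using this
  rw [Fin.sum_univ_two] at hXQ
  obtain ⟨r, h0, h1⟩ := exists_eq_mul_of_mul_add_mul_eq_zero hXQ hQ
  refine ⟨r, 2 * q, m, c, fun i => a i / b i, hc, ?_⟩
  rw [quadField_eq hk]
  exact funext (Fin.forall_fin_two.2 ⟨h0, h1⟩)

/-! ### Exceptionality of H. -/

variable [IsAlgClosed C]

/-- The constant lies in C, so it is a square b² there, and k = (w/b)². -/
theorem isSquare_of_sq_div_isConstant {k w : RatXY C} (hk : k ≠ 0) (hw : w ≠ 0)
    (h : IsConstant (partialDeriv C) (w ^ 2 / k)) : IsSquare k := by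
  obtain ⟨a, ha⟩ := exists_algebraMap_eq_of_isConstant h
  obtain ⟨b, rfl⟩ := IsAlgClosed.exists_pow_nat_eq a (n := 2) two_pos
  have hb : algebraMap C (RatXY C) b ≠ 0 := by
    intro hb
    rw [map_pow, hb, zero_pow two_ne_zero, eq_comm, div_eq_zero_iff] at ha
    exact ha.elim (pow_ne_zero 2 hw) hk
  refine ⟨w / algebraMap C _ b, ?_⟩
  rw [map_pow, eq_div_iff hk] at ha
  field_simp
  linear_combination ha

/-- A quadratic extension of `C(x, y)` has no new constants. -/
theorem exists_algebraMap_eq_of_isConstant_quadratic {F : Type*} [Field F] [Algebra C F]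
    [Algebra (RatXY C) F] {D : Fin 2 → Derivation C F F}
    (hD : ∀ j a, D j (algebraMap (RatXY C) F a) = algebraMap (RatXY C) F (partialDeriv C j a))
    (h2 : Module.finrank (RatXY C) F = 2) {k : RatXY C} (hk : ¬ IsSquare k) {s : F}
    (hs : s ^ 2 = algebraMap (RatXY C) F k) {f : F} (hf : IsConstant D f) :
    ∃ a, algebraMap (RatXY C) F a = f := by
  have hk0 : k ≠ 0 := by rintro rfl; exact hk (IsSquare.zero)
  have hsK := algebraMap_ne_of_not_isSquare hk hs
  obtain ⟨a, b, rfl⟩ := exists_add_mul_eq h2 hsK f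
  by_cases hb : b = 0
  · exact ⟨a, by simp [hb]⟩
  -- If a + bs is constant, so is bs, and hence so is its square b²k, which equals (bk)²/k.
  refine absurd (isSquare_of_sq_div_isConstant (k := k) (w := b * k) hk0 (mul_ne_zero hb hk0)
    fun j => ?_) hk
  have := hf j
  rw [derivation_add_mul_sqrt (hD j) hk0 hs, add_mul_eq_zero_iff hsK] at this
  have e : (b * k) ^ 2 / k = b ^ 2 * k := by field_simp
  have h2' := this.2
  rw [e]
  simp only [Derivation.leibniz, Derivation.leibniz_pow, smul_eq_mul, nsmul_eq_mul]
  field_simp at h2'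
  push_cast
  linear_combination b * h2'

theorem not_hasLogRelation_quadField {k : RatXY C} (hk : ¬ IsSquare k) (h : RatXY C) {m : ℕ}
    (c : Fin m → C) (g : Fin m → RatXY C)
    (hr : ¬ HasRationalFirstIntegral (quadField k h c g)) :
    ¬ HasLogRelation (partialDeriv C) (quadField k h c g) := by
  rintro ⟨n, c', u, v, -, hne, hX⟩
  have hk0 : k ≠ 0 := by rintro rfl; exact hk (IsSquare.zero)
  have hcl := logForm_closed (partialDeriv C) (partialDeriv_comm C) c' u v
  have hγ := sqrtForm_closed hk h c g
  rw [quadField_eq hk] at hX hr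
  generalize logForm (partialDeriv C) c' u v = β at hne hX hcl
  generalize sqrtForm (partialDeriv C 0) k h c g = γ₀ at hX hr hγ
  generalize sqrtForm (partialDeriv C 1) k h c g = γ₁ at hX hr hγ
  have hX' : γ₀ * β 1 = γ₁ * β 0 := by
    simp only [Fin.sum_univ_two, Algebra.algebraMap_self, RingHom.id_apply,
      Matrix.cons_val_zero, Matrix.cons_val_one] at hX
    linear_combination hX
  -- If γ were zero, H would vanish and every nonconstant rational function would be a first
  -- integral.
  have hγ0 : ¬ (γ₀ = 0 ∧ -γ₁ = 0) := by
    rintro ⟨h0, h1⟩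
    refine absurd (hasRationalFirstIntegral_zero (C := C)) ?_
    convert! hr
    funext j
    fin_cases j <;> simp [h0, h1]
  obtain ⟨w, hw1, hw0⟩ := exists_eq_mul_of_mul_add_mul_eq_zero (x := β 1) (y := β 0)
    (p := γ₀) (q := -γ₁) (by linear_combination hX') hγ0
  rw [neg_neg] at hw1
  have hw : w ≠ 0 := by
    rintro rfl
    refine hne ?_
    funext j
    fin_cases j
    · simpa using hw0
    · simpa using hw1
  rw [hw0, hw1] at hcl
  simp only [Derivation.leibniz, smul_eq_mul] at hcl
  by_cases hconst : IsConstant (partialDeriv C) (w ^ 2 / k)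
  · exact hk (isSquare_of_sq_div_isConstant hk0 hw hconst)
  -- Closedness of wγ and of sγ gives dw ∧ γ = -w dγ and ½(dk/k) ∧ γ = -dγ; hence d(w²/k) ∧ γ = 0.
  refine hr ⟨w ^ 2 / k, hconst, ?_⟩
  simp only [lieDeriv, Fin.sum_univ_two, Algebra.algebraMap_self, RingHom.id_apply,
    Matrix.cons_val_zero, Matrix.cons_val_one, Derivation.leibniz_div, Derivation.leibniz_pow,
    smul_eq_mul, nsmul_eq_mul]
  field_simp at hγ ⊢
  push_cast
  linear_combination -(2 * k * w) * hcl + w ^ 2 * hγ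

/-- The vector field `H` has an elementary first integral. -/
theorem hasElementaryFirstIntegral_quadField {k : RatXY C} (hk : ¬ IsSquare k) (h : RatXY C)
    {m : ℕ} (c : Fin m → C) (g : Fin m → RatXY C) (hne : quadField k h c g ≠ 0) :
    HasElementaryFirstIntegral (quadField k h c g) := by
  have hk0 : k ≠ 0 := by rintro rfl; exact hk (IsSquare.zero)
  obtain ⟨F, _, _, _, _, d, s, hd, hdc, hs, h2⟩ := exists_quadratic_extension hk
  have : CharZero F := charZero_of_injective_algebraMap (algebraMap (RatXY C) F).injective
  have hsK := algebraMap_ne_of_not_isSquare hk hs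
  have hs0 : s ≠ 0 := by
    rintro rfl
    exact hsK 0 (map_zero _)
  let u : Fin m → F := fun i => (algebraMap _ F (g i) + s) / (algebraMap _ F (g i) - s)
  have hu : ∀ i, u i ≠ 0 := fun i =>
    div_ne_zero (add_sqrt_ne_zero hk hs _) (sub_sqrt_ne_zero hk hs _)
  obtain ⟨L, _, _, _, _, D, t, hD, hDc, hDk, ht, htS⟩ := exists_log_extension d hdc u hu
  let _ : Algebra (RatXY C) L := Algebra.compHom L (algebraMap (RatXY C) F)
  have : IsScalarTower (RatXY C) F L := IsScalarTower.of_algebraMap_eq fun _ => rfl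
  have hKL : ∀ a, algebraMap (RatXY C) L a = algebraMap F L (algebraMap (RatXY C) F a) :=
    fun _ => rfl
  have hCKL : IsScalarTower C (RatXY C) L := IsScalarTower.of_algebraMap_eq fun a => by
    rw [hKL, ← IsScalarTower.algebraMap_apply C (RatXY C) F,
      ← IsScalarTower.algebraMap_apply C F L]
  let s' := algebraMap F L s
  have hs' : s' ^ 2 = algebraMap (RatXY C) L k := by rw [hKL, ← hs, map_pow]
  have hint : IsIntegral (RatXY C) s' :=
    ⟨X ^ 2 - Polynomial.C k, monic_X_pow_sub_C k two_ne_zero, by simp [hs']⟩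
  let E : IntermediateField (RatXY C) L := IntermediateField.adjoin (RatXY C) {s'}
  have hE : IsElementaryTower D E := by
    refine .algebraic ⊥ E .base bot_le ?_
    have : FiniteDimensional (RatXY C) E := IntermediateField.adjoin.finiteDimensional hint
    have : FiniteDimensional (RatXY C) (IntermediateField.extendScalars (bot_le : ⊥ ≤ E)) := this
    exact Module.Finite.of_restrictScalars_finite (RatXY C) _ _
  have hFE : ∀ a, algebraMap F L a ∈ E := fun a => by
    obtain ⟨p, q, rfl⟩ := exists_add_mul_eq h2 hsK a
    rw [map_add, map_mul, ← hKL, ← hKL]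
    exact add_mem (E.algebraMap_mem p) (mul_mem (E.algebraMap_mem q)
      (IntermediateField.mem_adjoin_simple_self _ _))
  -- The tower starts with the algebraic step K(√k) and gains one logarithm at a time.
  have htower : ∀ A : Finset (Fin m), ∃ T : IntermediateField (RatXY C) L,
      IsElementaryTower D T ∧ E ≤ T ∧ ∀ i ∈ A, t i ∈ T := by
    intro A
    induction A using Finset.induction_on with
    | empty => exact ⟨E, hE, le_rfl, by simp⟩
    | insert i A _ ih =>
      obtain ⟨T, hT, hET, hAT⟩ := ih
      refine ⟨_, .logarithm T (t i) (algebraMap F L (u i)) hT (hET (hFE _))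
        (by simpa using hu i) (fun j => by rw [ht, hD, map_div₀]), hET.trans le_sup_left,
        fun l hl => ?_⟩
      rcases Finset.mem_insert.1 hl with rfl | hl
      · exact (le_sup_right : _ ≤ T ⊔ _) (IntermediateField.mem_adjoin_simple_self _ _)
      · exact (le_sup_left : T ≤ T ⊔ _) (hAT l hl)
  obtain ⟨T, hT, hET, htT⟩ := htower Finset.univ
  -- `L` is generated as a field by `F` and the logarithms, so the tower exhausts it.
  have hTtop : T = ⊤ := by
    have := htS T.toSubfield (fun a => hET (hFE a)) fun i => htT i (Finset.mem_univ i)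
    exact eq_top_iff.2 fun a _ => (this ▸ Subfield.mem_top a : a ∈ T.toSubfield)
  have hφ : ∀ j, D j (∑ i, c i • t i + algebraMap F L (algebraMap _ F h * s)) =
      algebraMap _ L (sqrtForm (partialDeriv C j) k h c g) * s' := fun j => by
    rw [hKL, ← map_mul, ← logForm_sqrt hd hk hs]
    simp only [logForm, map_add, map_sum, Derivation.map_smul, ht, hD]
    congr 1
    refine Finset.sum_congr rfl fun i _ => ?_
    rw [Algebra.smul_def, Algebra.smul_def, map_mul, ← IsScalarTower.algebraMap_apply]
  refine ⟨L, inferInstance, inferInstance, inferInstance, hCKL, D,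
    ⟨⟨fun j a => by rw [hKL, hD, hd, hKL], hDc⟩, fun f hf => ?_, hTtop ▸ hT⟩,
    ∑ i, c i • t i + algebraMap F L (algebraMap _ F h * s), fun h0 => hne ?_, ?_⟩
  · obtain ⟨a, ha, rfl⟩ := hDk f hf
    obtain ⟨b, rfl⟩ := exists_algebraMap_eq_of_isConstant_quadratic hd h2 hk hs ha
    exact ⟨b, rfl⟩
  · have hs0' : s' ≠ 0 := by simpa [s'] using hs0
    have hz : ∀ j, sqrtForm (partialDeriv C j) k h c g = 0 := fun j => by
      have := h0 j
      rw [hφ, mul_eq_zero, or_iff_left hs0', map_eq_zero] at this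
      exact this
    rw [quadField_eq hk]
    funext j
    fin_cases j <;> simp [hz]
  · rw [lieDeriv, quadField_eq hk, Fin.sum_univ_two, hφ, hφ]
    simp only [Matrix.cons_val_zero, Matrix.cons_val_one, map_neg]
    ring

/-- The primitive of γs is nonconstant only for H ≠ 0; the zero field has a rational first integral,
so it is excluded. -/
theorem isExceptional_quadField_iff {k : RatXY C} (hk : ¬ IsSquare k) (h : RatXY C)
    {m : ℕ} (c : Fin m → C) (g : Fin m → RatXY C) :
    IsExceptional (quadField k h c g) ↔ ¬ HasRationalFirstIntegral (quadField k h c g) := by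
  refine ⟨fun he hr => he.2 hr.hasLogRelation, fun hr =>
    ⟨?_, not_hasLogRelation_quadField hk h c g hr⟩⟩
  refine hasElementaryFirstIntegral_quadField hk h c g fun h0 => hr ?_
  rw [h0]
  exact hasRationalFirstIntegral_zero

end

end PlaneVF

end

theorem mainTheorem4 {C : Type*} [Field C] [IsAlgClosed C] [CharZero C] :
    (∀ (L : Type*) [Field L] [Algebra C L] [Algebra (PlaneVF.RatXY C) L]
        [IsScalarTower C (PlaneVF.RatXY C) L] (D : Fin 2 → Derivation C L L),
      PlaneVF.IsDifferentialExtension D → Module.finrank (PlaneVF.RatXY C) L = 2 →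
      ∀ X : Fin 2 → PlaneVF.RatXY C,
        PlaneVF.IsExceptional X → PlaneVF.HasLogRelation D X →
        (∃ k : PlaneVF.RatXY C, PlaneVF.IsQuadraticGenerator L k) ∧
        ∀ k : PlaneVF.RatXY C, PlaneVF.IsQuadraticGenerator L k →
          ∃ (r h : PlaneVF.RatXY C) (m : ℕ) (c : Fin m → C) (g : Fin m → PlaneVF.RatXY C),
            LinearIndependent ℚ c ∧ X = r • PlaneVF.quadField k h c g) ∧
    (∀ (k h : PlaneVF.RatXY C) (m : ℕ) (c : Fin m → C) (g : Fin m → PlaneVF.RatXY C),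
      ¬ IsSquare k →
        (PlaneVF.IsExceptional (PlaneVF.quadField k h c g) ↔
          ¬ PlaneVF.HasRationalFirstIntegral (PlaneVF.quadField k h c g))) := by
  refine ⟨fun L _ _ _ _ D hD h2 X hX hL => ⟨PlaneVF.exists_sqrt_generator h2, ?_⟩,
    fun k h m c g hk => PlaneVF.isExceptional_quadField_iff hk h c g⟩
  rintro k ⟨hk, s, hs⟩
  exact PlaneVF.exists_eq_smul_quadField hD.1 h2 hX.2 hL hk hs
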